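/- For a finite set (dictionary) $C\subset\mathbb R^n$ and an integer $k\ge 0$ let $$d_k(y,C)=\min\Big\{\big\|y-\textstyle\sum_{i=1}^k x_i\varphi_i\big\|^2 : x_1,\dots,x_k\in\mathbb R,\ \varphi_1,\dots,\varphi_k\in C\Big\}\quad(y\in\mathbb R^n),\qquad d_k^*(C)=\sup_{\|y\|\le 1}d_k(y,C),$$ with the Euclidean norm. A greedy successive representation of $y$ from $C$ is a sequence of errors $z_0=y,\ z_1,z_2,\dots$ with $z_{i+1}=z_i-x\varphi$, where $\varphi\in C$ and $x\in\mathbb R$ minimize $\|z_i-x\varphi\|$ over all elements of $C$ and all real multiples. Let $g_k(C)$ be the supremum of $\|z_k\|^2$ over all $\|y\|\le 1$ and all greedy successive representations of $y$ from $C$; it is at least $d_k^*(C)$ when $C\neq\emptyset$. Put $\log 0=-\infty$ for the logarithm of a distortion. **Theorem 1.** Let $(M_n)$ be a sequence of nonnegative integers with $\liminf_{n\to\infty}\frac{\log M_n}{n}>0$ (the value $+\infty$ is allowed). Then there are dictionaries $C_n\subset\mathbb R^n$ with $|C_n|=M_n$ for all $n\ge1$ such that: 1. for every sequence $k=k_n$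 of nonnegative integers (in particular for every constant $k$), $$\limsup_{n\to\infty}\Big[\log d_{k}^*(C_n)+\frac{2k\log M_n}{n}\Big]\le 0;$$ 2. in particular, if $k_n\to\infty$ as $n\to\infty$, then $d_{k_n}^*(C_n)\to0$; 3. the bound is achieved by the greedy successive representation from the same dictionaries: for every constant $k$, $$\limsup_{n\to\infty}\Big[\log g_k(C_n)+\frac{2k\log M_n}{n}\Big]\le 0,$$ and, uniformly in $k$, for every $\varepsilon>0$ there is $n_0$ such that for all $n\ge n_0$ and all $k\ge0$ $$g_k(C_n)\le \exp\Big(-2k\Big(\frac{\log M_n}{n}-\varepsilon\Big)\Big).$$ -/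

import Mathlib

open Filter Topology
open scoped ENNReal

/-- The squared error `d_k(y, C)` of the best `k`-term linear representation of the signal `y` from
the dictionary `C`: the least value of `‖y - (x₁ φ₁ + ⋯ + x_k φ_k)‖²` over real coefficients `x`
and (not necessarily distinct) dictionary elements `φ`. -/
noncomputable def sparseError {n : ℕ} (k : ℕ) (C : Finset (EuclideanSpace ℝ (Fin n)))
    (y : EuclideanSpace ℝ (Fin n)) : ℝ≥0∞ :=
  ⨅ (x : Fin k → ℝ) (φ : Fin k → C),
    ‖y - ∑ i, x i • (φ i : EuclideanSpace ℝ (Fin n))‖ₑ ^ 2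

/-- The worst-case distortion `d_k^*(C)`: the supremum of `d_k(y, C)` over the closed unit ball. -/
noncomputable def worstDistortion {n : ℕ} (k : ℕ) (C : Finset (EuclideanSpace ℝ (Fin n))) :
    ℝ≥0∞ :=
  ⨆ (y : EuclideanSpace ℝ (Fin n)) (_ : ‖y‖ ≤ 1), sparseError k C y

/-- `z` is a sequence of errors of the successive representation of `y` from `C`: `z 0` is the
signal `y`, and `z (i + 1)` is the error left by a best representation of `z i` as a real multiple
of one element of `C`. (If several best representations exist, any of them may be used.) -/
def IsGreedyErrorSeq {n : ℕ} (C : Finset (EuclideanSpace ℝ (Fin n)))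
    (y : EuclideanSpace ℝ (Fin n)) (z : ℕ → EuclideanSpace ℝ (Fin n)) : Prop :=
  z 0 = y ∧ ∀ i, ∃ φ ∈ C, ∃ x : ℝ, z (i + 1) = z i - x • φ ∧
    ∀ ψ ∈ C, ∀ t : ℝ, ‖z i - x • φ‖ ≤ ‖z i - t • ψ‖

/-- The worst squared error after `k` steps of the successive representation, over all signals in
the closed unit ball and all choices of the best representations. -/
noncomputable def greedyDistortion {n : ℕ} (k : ℕ) (C : Finset (EuclideanSpace ℝ (Fin n))) :
    ℝ≥0∞ :=
  ⨆ (y : EuclideanSpace ℝ (Fin n)) (_ : ‖y‖ ≤ 1)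
    (z : ℕ → EuclideanSpace ℝ (Fin n)) (_ : IsGreedyErrorSeq C y z), ‖z k‖ₑ ^ 2

/-- For a nonempty dictionary every signal has a successive representation, so the supremum in
`greedyDistortion` is not over an empty family. -/
theorem exists_isGreedyErrorSeq {n : ℕ} (C : Finset (EuclideanSpace ℝ (Fin n)))
    (hC : C.Nonempty) (y : EuclideanSpace ℝ (Fin n)) : ∃ z, IsGreedyErrorSeq C y z := by
  have single : ∀ w φ : EuclideanSpace ℝ (Fin n), ∃ x : ℝ, ∀ t : ℝ,
      ‖w - x • φ‖ ≤ ‖w - t • φ‖ := by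
    intro w φ
    obtain ⟨v, hv, hmin⟩ := Submodule.exists_norm_eq_iInf_of_complete_subspace
      (𝕜 := ℝ) (Submodule.span ℝ {φ}) (Submodule.complete_of_finiteDimensional _) w
    obtain ⟨x, rfl⟩ := Submodule.mem_span_singleton.1 hv
    refine ⟨x, fun t => ?_⟩
    rw [hmin]
    exact ciInf_le ⟨0, by rintro _ ⟨_, rfl⟩; exact norm_nonneg _⟩
      (⟨t • φ, Submodule.mem_span_singleton.2 ⟨t, rfl⟩⟩ : Submodule.span ℝ {φ})
  have step : ∀ w : EuclideanSpace ℝ (Fin n), ∃ w', ∃ φ ∈ C, ∃ x : ℝ, w' = w - x • φ ∧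
      ∀ ψ ∈ C, ∀ t : ℝ, ‖w - x • φ‖ ≤ ‖w - t • ψ‖ := by
    intro w
    choose x hx using single w
    obtain ⟨φ, hφ, hm⟩ := C.exists_min_image (fun ψ => ‖w - x ψ • ψ‖) hC
    exact ⟨_, φ, hφ, x φ, rfl, fun ψ hψ t => (hm ψ hψ).trans (hx ψ t)⟩
  choose f hf using step
  exact ⟨fun i => f^[i] y, rfl, fun i => by
    simpa only [Function.iterate_succ_apply'] using hf (f^[i] y)⟩

/-! Write ℓ = log M. In dimension d, a random vector of the unit ball spans a line within `exp (-σ)`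
of a given unit vector with probability about `exp (-σ (d - 1))`, up to polynomial factors. Hence
about `exp (σ (d - 1))` vectors can hit the caps around all points of a fine net of the sphere
(`exists_line_cover`). For d = n this gives relative error about exp(-ℓ/n) per term. The relative
error bound applies to every residual, so it iterates along greedy steps, but each step loses
`stepLoss`, of order log n / n, in the exponent. This suffices for constant k and for the uniform
ε-bound.

For arbitrary k = k_n these losses could accumulate. Therefore the dictionary also contains line
covers of B blocks of about √(n/2) coordinates. One term per block gives relative error exp(-τ) with
B terms (`exists_dictionary`). In a block of size m the exponent is nearly ℓ/(m - 1), because a cap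
has only m - 1 small directions, while the target for B terms is Bℓ/n, about ℓ/m. The gap pays for
the polynomial factors and for rounding (`eventually_logOverhead_le`), so whole rounds of B terms
lose nothing. Only the remaining k mod B terms lose, and B log n / n tends to 0. -/

/-! ### Sphere nets and random hitting sets. -/

open MeasureTheory Module in
/-- Volume bound for separated subsets of the unit ball. -/
theorem card_mul_pow_le_of_separated {E : Type*} [NormedAddCommGroup E] [NormedSpace ℝ E]
    [FiniteDimensional ℝ E] {δ : ℝ} (hδ : 0 < δ) (s : Finset E) (hs : ∀ c ∈ s, ‖c‖ ≤ 1)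
    (h : ∀ c ∈ s, ∀ d ∈ s, c ≠ d → 2 * δ ≤ ‖c - d‖) :
    (s.card : ℝ) * δ ^ finrank ℝ E ≤ (1 + δ) ^ finrank ℝ E := by
  borelize E
  let μ : Measure E := Measure.addHaar
  have hρ : 0 < 1 + δ := by linarith
  have disj : Set.PairwiseDisjoint (s : Set E) fun c => Metric.ball (c : E) δ := by
    rintro c hc d hd hcd
    apply Metric.ball_disjoint_ball
    rw [dist_eq_norm]
    linarith [h c hc d hd hcd]
  have sub : (⋃ c ∈ s, Metric.ball (c : E) δ) ⊆ Metric.ball (0 : E) (1 + δ) := by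
    refine Set.iUnion₂_subset fun x hx => Metric.ball_subset_ball' ?_
    rw [dist_zero_right]
    linarith [hs x hx]
  have key : (s.card : ℝ≥0∞) * ENNReal.ofReal (δ ^ finrank ℝ E) * μ (Metric.ball 0 1) ≤
      ENNReal.ofReal ((1 + δ) ^ finrank ℝ E) * μ (Metric.ball 0 1) := by
    rw [← μ.addHaar_ball_of_pos (0 : E) hρ]
    refine le_trans (le_of_eq ?_) (measure_mono sub)
    rw [measure_biUnion_finset disj fun c _ => measurableSet_ball]
    simp only [μ.addHaar_ball_of_pos _ hδ, Finset.sum_const, nsmul_eq_mul, mul_assoc]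
  have key' := (ENNReal.mul_le_mul_iff_left (Metric.measure_ball_pos μ _ zero_lt_one).ne'
    measure_ball_lt_top.ne).1 key
  have := ENNReal.toReal_le_of_le_ofReal (pow_nonneg hρ.le _) key'
  rwa [ENNReal.toReal_mul, ENNReal.toReal_natCast,
    ENNReal.toReal_ofReal (pow_nonneg hδ.le _)] at this

open Module in
/-- The unit sphere has an `η`-net with at most `(1 + 2 / η) ^ dim` points. -/
theorem exists_sphere_net (E : Type*) [NormedAddCommGroup E] [NormedSpace ℝ E]
    [FiniteDimensional ℝ E] {η : ℝ} (hη : 0 < η) :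
    ∃ T : Finset E, (∀ u ∈ T, ‖u‖ = 1) ∧ (T.card : ℝ) ≤ (1 + 2 / η) ^ finrank ℝ E ∧
      ∀ y : E, ‖y‖ = 1 → ∃ u ∈ T, ‖y - u‖ ≤ η := by
  classical
  -- A separated set of largest cardinality is a net; the volume bound ensures that a largest one
  -- exists.
  let P : ℕ → Prop := fun N => ∃ T : Finset E, (∀ u ∈ T, ‖u‖ = 1) ∧
    (∀ c ∈ T, ∀ d ∈ T, c ≠ d → η ≤ ‖c - d‖) ∧ T.card = N
  have bound : ∀ T : Finset E, (∀ u ∈ T, ‖u‖ = 1) →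
      (∀ c ∈ T, ∀ d ∈ T, c ≠ d → η ≤ ‖c - d‖) →
      (T.card : ℝ) ≤ (1 + 2 / η) ^ finrank ℝ E := by
    intro T hT hsep
    have := card_mul_pow_le_of_separated (half_pos hη) T (fun c hc => (hT c hc).le)
      (fun c hc d hd hcd => by linarith [hsep c hc d hd hcd])
    rw [← le_div_iff₀ (by positivity), ← div_pow] at this
    have e : (1 + η / 2) / (η / 2) = 1 + 2 / η := by field_simp; ring
    rwa [e] at this
  have hbdd : ∀ N, P N → N ≤ ⌊(1 + 2 / η) ^ finrank ℝ E⌋₊ := by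
    rintro N ⟨T, h1, h2, rfl⟩
    exact Nat.le_floor (bound T h1 h2)
  obtain ⟨T, h1, h2, h3⟩ : P (Nat.findGreatest P ⌊(1 + 2 / η) ^ finrank ℝ E⌋₊) :=
    Nat.findGreatest_spec (Nat.zero_le _) ⟨∅, by simp, by simp, rfl⟩
  refine ⟨T, h1, bound T h1 h2, fun y hy => ?_⟩
  by_contra! hcon
  have hyT : y ∉ T := fun hyT => by
    have := hcon y hyT
    simp only [sub_self, norm_zero] at this
    linarith
  have hP : P (T.card + 1) := by
    refine ⟨insert y T, ?_, ?_, Finset.card_insert_of_notMem hyT⟩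
    · simpa [hy] using h1
    · intro c hc d hd hcd
      rcases Finset.mem_insert.1 hc with rfl | hc' <;> rcases Finset.mem_insert.1 hd with rfl | hd'
      · exact absurd rfl hcd
      · exact (hcon d hd').le
      · rw [norm_sub_rev]; exact (hcon c hc').le
      · exact h2 c hc' d hd' hcd
  have := Nat.le_findGreatest (hbdd _ hP) hP
  omega

open MeasureTheory in
/-- If every set of a finite family has probability at least `p`, then `N` points can be chosen so
that at most a fraction `(1 - p) ^ N` of the family contains none of them. -/
theorem exists_finset_card_unhit_le {Ω ι : Type*} [MeasurableSpace Ω] (ν : Measure Ω)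
    [IsProbabilityMeasure ν] (T : Finset ι) (A : ι → Set Ω) (hA : ∀ u ∈ T, MeasurableSet (A u))
    {p : ℝ} (hp1 : p ≤ 1) (hAp : ∀ u ∈ T, ENNReal.ofReal p ≤ ν (A u)) (N : ℕ) :
    ∃ (D : Finset Ω) (U : Finset ι), D.card ≤ N ∧ U ⊆ T ∧ (U.card : ℝ) ≤ (1 - p) ^ N * T.card ∧
      ∀ u ∈ T, u ∉ U → ∃ ω ∈ D, ω ∈ A u := by
  classical
  induction N with
  | zero => exact ⟨∅, T, by simp, subset_rfl, by simp, fun u h h' => absurd h h'⟩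
  | succ N ih =>
    obtain ⟨D, U, hD, hUT, hU, hcov⟩ := ih
    -- Averaging: some `ω` lies in at least the expected number of the sets not yet hit, hence in at
    -- least `p * U.card` of them.
    obtain ⟨ω, hω⟩ := exists_lintegral_le (μ := ν)
      (f := fun ω => ∑ u ∈ U, (A u).indicator (fun _ => (1 : ℝ≥0∞)) ω) (by
        rw [lintegral_finsetSum' _ fun u hu =>
          (measurable_const.indicator (hA u (hUT hu))).aemeasurable]
        refine (ENNReal.sum_lt_top.2 fun u hu => ?_).ne
        rw [lintegral_indicator (hA u (hUT hu))]
        simp)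
    have hsum : ENNReal.ofReal (U.card * p) ≤ (U.filter fun u => ω ∈ A u).card := by
      calc ENNReal.ofReal (U.card * p) = ∑ u ∈ U, ENNReal.ofReal p := by
            rw [Finset.sum_const, nsmul_eq_mul, ENNReal.ofReal_mul (by positivity),
              ENNReal.ofReal_natCast]
        _ ≤ ∑ u ∈ U, ν (A u) := Finset.sum_le_sum fun u hu => hAp u (hUT hu)
        _ = ∫⁻ ω, ∑ u ∈ U, (A u).indicator (fun _ => (1 : ℝ≥0∞)) ω ∂ν := by
            rw [lintegral_finsetSum' _ fun u hu =>
              (measurable_const.indicator (hA u (hUT hu))).aemeasurable]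
            refine Finset.sum_congr rfl fun u hu => ?_
            rw [lintegral_indicator (hA u (hUT hu))]
            simp
        _ ≤ _ := hω
        _ = _ := by simp [Set.indicator_apply, Finset.sum_boole]
    have hsum' : U.card * p ≤ (U.filter fun u => ω ∈ A u).card := by
      rw [← ENNReal.ofReal_natCast] at hsum
      exact (ENNReal.ofReal_le_ofReal_iff (by positivity)).1 hsum
    have hsplit := Finset.card_filter_add_card_filter_not (s := U) (fun u => ω ∈ A u)
    refine ⟨insert ω D, U.filter fun u => ω ∉ A u, ?_, (Finset.filter_subset _ _).trans hUT, ?_, ?_⟩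
    · exact (Finset.card_insert_le _ _).trans (by omega)
    · have h1 : ((U.filter fun u => ω ∉ A u).card : ℝ) ≤ (1 - p) * U.card := by
        have : ((U.filter fun u => ω ∈ A u).card : ℝ) + (U.filter fun u => ω ∉ A u).card
          = U.card := by exact_mod_cast hsplit
        linarith
      calc _ ≤ (1 - p) * U.card := h1
        _ ≤ (1 - p) * ((1 - p) ^ N * T.card) := by gcongr
        _ = _ := by ring
    · intro u hu hnu
      by_cases hω' : ω ∈ A u
      · exact ⟨ω, Finset.mem_insert_self _ _, hω'⟩
      · obtain ⟨ω', h, h'⟩ := hcov u hu fun hU' => hnu (Finset.mem_filter.2 ⟨hU', hω'⟩)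
        exact ⟨ω', Finset.mem_insert_of_mem h, h'⟩

open MeasureTheory in
-- With N = ⌊R/p⌋ + 1 points, (1 - p)^N ≤ exp(-pN) < exp(-R), so fewer than one set is left unhit.
theorem exists_finset_hitting {Ω ι : Type*} [MeasurableSpace Ω] (ν : Measure Ω)
    [IsProbabilityMeasure ν] (T : Finset ι) (A : ι → Set Ω) (hA : ∀ u ∈ T, MeasurableSet (A u))
    {p : ℝ} (hp : 0 < p) (hp1 : p ≤ 1) (hAp : ∀ u ∈ T, ENNReal.ofReal p ≤ ν (A u))
    {R : ℝ} (hTR : (T.card : ℝ) ≤ Real.exp R) (hR : 0 ≤ R) :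
    ∃ D : Finset Ω, (D.card : ℝ) ≤ R / p + 1 ∧ ∀ u ∈ T, ∃ ω ∈ D, ω ∈ A u := by
  obtain ⟨D, U, hD, -, hU, hcov⟩ :=
    exists_finset_card_unhit_le ν T A hA hp1 hAp (⌊R / p⌋₊ + 1)
  have hU0 : U = ∅ := by
    rw [← Finset.card_eq_zero, ← Nat.lt_one_iff, ← Nat.cast_lt (α := ℝ)]
    refine hU.trans_lt ?_
    have h1 : (1 - p) ^ (⌊R / p⌋₊ + 1) ≤ Real.exp (-p) ^ (⌊R / p⌋₊ + 1) :=
      pow_le_pow_left₀ (by linarith) (by linarith [Real.add_one_le_exp (-p)]) _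
    have h2 : R < p * ((⌊R / p⌋₊ + 1 : ℕ) : ℝ) := by
      have := Nat.lt_floor_add_one (R / p)
      rw [div_lt_iff₀ hp] at this
      push_cast
      linarith
    calc _ ≤ Real.exp (-p) ^ (⌊R / p⌋₊ + 1) * Real.exp R := by gcongr
      _ = Real.exp (R - p * ((⌊R / p⌋₊ + 1 : ℕ) : ℝ)) := by
        rw [← Real.exp_nat_mul, ← Real.exp_add]; ring_nf
      _ < _ := by
        rw [Nat.cast_one, ← Real.exp_zero]
        exact Real.exp_lt_exp.2 (by linarith)
  refine ⟨D, ?_, fun u hu => hcov u hu (by simp [hU0])⟩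
  calc (D.card : ℝ) ≤ ((⌊R / p⌋₊ + 1 : ℕ) : ℝ) := by exact_mod_cast hD
    _ ≤ R / p + 1 := by
      push_cast
      gcongr
      exact Nat.floor_le (by positivity)

/-! ### Measure of caps. -/

section Cap
variable {E : Type*} [NormedAddCommGroup E] [InnerProductSpace ℝ E]

/-- The orthogonal projection of `u` onto the line of `t • u + v` leaves squared error ‖v‖² / (t² +
‖v‖²); `h` says that this is at most s², with denominators cleared. -/
theorem exists_norm_sub_smul_le_of_orthogonal {u v : E} (hu : ‖u‖ = 1) (huv : inner ℝ u v = 0)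
    {t s : ℝ} (ht : 0 < t) (hs : 0 ≤ s) (h : ‖v‖ ^ 2 * (1 - s ^ 2) ≤ s ^ 2 * t ^ 2) :
    ∃ x : ℝ, ‖u - x • (t • u + v)‖ ≤ s := by
  have hpos : 0 < t ^ 2 + ‖v‖ ^ 2 := by positivity
  refine ⟨t / (t ^ 2 + ‖v‖ ^ 2), ?_⟩
  set x := t / (t ^ 2 + ‖v‖ ^ 2) with hx
  have hxe : x * (t ^ 2 + ‖v‖ ^ 2) = t := by rw [hx]; field_simp
  have e : u - x • (t • u + v) = (1 - x * t) • u + (-x) • v := by module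
  have hsq : ‖u - x • (t • u + v)‖ ^ 2 = (1 - x * t) ^ 2 + x ^ 2 * ‖v‖ ^ 2 := by
    rw [e, norm_add_sq_real, inner_smul_left, inner_smul_right, huv, norm_smul, norm_smul, hu]
    simp [mul_pow]
  have h2 : (1 - x * t) ^ 2 + x ^ 2 * ‖v‖ ^ 2 = 1 - x * t := by
    linear_combination x * hxe
  refine le_of_sq_le_sq ?_ hs
  rw [hsq, h2]
  have : (1 - x * t) * (t ^ 2 + ‖v‖ ^ 2) = ‖v‖ ^ 2 := by linear_combination (-t) * hxe
  refine le_of_mul_le_mul_right ?_ hpos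
  rw [this]
  linarith

open Module in
-- The map stretches `u` by `α` and the orthogonal complement of `u` by `ρ`.
theorem det_smul_add_inner_smul [FiniteDimensional ℝ E] {u : E} (hu : ‖u‖ = 1) {ρ : ℝ}
    (hρ : ρ ≠ 0) (α : ℝ) :
    LinearMap.det (ρ • LinearMap.transvection (innerₛₗ ℝ u) (((α - ρ) / ρ) • u)) =
      ρ ^ (finrank ℝ E - 1) * α := by
  have hd : 0 < finrank ℝ E := by
    have : Nontrivial E := ⟨u, 0, by rintro rfl; simp at hu⟩
    exact finrank_pos
  rw [LinearMap.det_smul, LinearMap.transvection.det]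
  have : (innerₛₗ ℝ u) (((α - ρ) / ρ) • u) = (α - ρ) / ρ := by
    simp [hu]
  rw [this, ← Nat.sub_add_cancel hd, pow_succ, Nat.add_sub_cancel]
  field_simp
  ring

open MeasureTheory Module in
/-- A lower bound, sharp up to a factor polynomial in the dimension, for the proportion of the unit
ball that consists of vectors spanning a line at distance at most `s` from the unit vector `u`. -/
theorem exists_cap_measure_ge [FiniteDimensional ℝ E] [MeasurableSpace E] [BorelSpace E]
    (μ : Measure E) [μ.IsAddHaarMeasure] {u : E} (hu : ‖u‖ = 1) {s θ : ℝ} (hs : 0 < s)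
    (hs1 : s < 1) (hθ : 0 < θ) (hθ1 : θ < 1) :
    ∃ A : Set E, MeasurableSet A ∧ A ⊆ Metric.closedBall 0 1 ∧
      μ A = ENNReal.ofReal ((θ * s) ^ (finrank ℝ E - 1) * (√(1 - s ^ 2) * (1 - θ) / 2)) *
        μ (Metric.closedBall 0 1) ∧
      ∀ φ ∈ A, ∃ x : ℝ, ‖u - x • φ‖ ≤ s := by
  -- The set will be an ellipsoid centred at `a • u`, with semi-axis `α` along `u` and `ρ` across.
  -- Its heights along `u` fill [cθ, c] and its radius is at most θs. It lies in the ball because c²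
  -- + s² = 1, and every slope is at most θs / (cθ) = s / c, so every angle with `u` has sine at
  -- most s.
  set c := √(1 - s ^ 2) with hc
  have hs2 : 0 < 1 - s ^ 2 := by nlinarith
  have hcpos : 0 < c := Real.sqrt_pos.2 hs2
  have hc2 : c ^ 2 = 1 - s ^ 2 := Real.sq_sqrt hs2.le
  set ρ := θ * s with hρ
  have hρpos : 0 < ρ := by positivity
  set α := c * (1 - θ) / 2 with hα
  have hαpos : 0 < α := by have := sub_pos.2 hθ1; positivity
  set a := c * (1 + θ) / 2 with ha
  set f : E →ₗ[ℝ] E := ρ • LinearMap.transvection (innerₛₗ ℝ u) (((α - ρ) / ρ) • u) with hf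
  have hfx : ∀ x, a • u + f x = (a + α * inner ℝ u x) • u + ρ • (x - inner ℝ u x • u) := by
    intro x
    have : f x = ρ • x + (α - ρ) • inner ℝ u x • u := by
      simp only [hf, LinearMap.smul_apply, LinearMap.transvection.apply, innerₛₗ_apply_apply,
        smul_add, smul_smul]
      congr 2
      field_simp
    rw [this]
    module
  have huu : inner ℝ u u = (1 : ℝ) := by rw [real_inner_self_eq_norm_sq, hu, one_pow]
  have horth : ∀ x, inner ℝ u (ρ • (x - inner ℝ u x • u)) = (0 : ℝ) := by
    intro x
    rw [inner_smul_right, inner_sub_right, inner_smul_right, huu]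
    ring
  have hv : ∀ x : E, ‖x‖ ≤ 1 → ‖ρ • (x - (inner ℝ u x : ℝ) • u)‖ ^ 2 ≤ ρ ^ 2 := by
    intro x hx
    have : ‖x - (inner ℝ u x : ℝ) • u‖ ^ 2 = ‖x‖ ^ 2 - (inner ℝ u x : ℝ) ^ 2 := by
      rw [norm_sub_sq_real, inner_smul_right, norm_smul, hu, real_inner_comm, Real.norm_eq_abs,
        mul_one, sq_abs]
      ring
    rw [norm_smul, mul_pow, this, Real.norm_eq_abs, sq_abs]
    have : ‖x‖ ^ 2 ≤ 1 := pow_le_one₀ (norm_nonneg _) hx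
    nlinarith [sq_nonneg ρ, sq_nonneg (inner ℝ u x : ℝ)]
  have ht : ∀ x : E, ‖x‖ ≤ 1 → c * θ ≤ a + α * inner ℝ u x ∧ a + α * inner ℝ u x ≤ c := by
    intro x hx
    have : |(inner ℝ u x : ℝ)| ≤ 1 := (abs_real_inner_le_norm u x).trans (by rwa [hu, one_mul])
    have h1 := abs_le.1 this
    have e1 : c * θ = a - α := by rw [ha, hα]; ring
    have e2 : c = a + α := by rw [ha, hα]; ring
    constructor
    · rw [e1]; nlinarith
    · conv_rhs => rw [e2]
      nlinarith
  refine ⟨(fun x => a • u + x) '' (f '' Metric.closedBall 0 1), ?_, ?_, ?_, ?_⟩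
  · have h1 : IsCompact (f '' Metric.closedBall 0 1) :=
      (isCompact_closedBall 0 1).image f.continuous_of_finiteDimensional
    exact (h1.image (by fun_prop)).measurableSet
  · rintro _ ⟨_, ⟨x, hx, rfl⟩, rfl⟩
    rw [mem_closedBall_zero_iff] at hx ⊢
    refine le_of_sq_le_sq ?_ zero_le_one
    dsimp only
    rw [hfx, norm_add_sq_real, inner_smul_left, horth, norm_smul, hu, Real.norm_eq_abs]
    have h1 := hv x hx
    obtain ⟨h2, h3⟩ := ht x hx
    have h4 : (a + α * inner ℝ u x) ^ 2 ≤ c ^ 2 := by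
      have : 0 < c * θ := by positivity
      exact pow_le_pow_left₀ (by linarith) h3 2
    have h5 : ρ ^ 2 ≤ s ^ 2 := pow_le_pow_left₀ hρpos.le (by rw [hρ]; nlinarith) 2
    simp only [mul_one, sq_abs, mul_zero, add_zero]
    linarith
  · rw [Set.image_add_left, measure_preimage_add, Measure.addHaar_image_linearMap,
      det_smul_add_inner_smul hu hρpos.ne', abs_of_nonneg (by positivity)]
  · rintro _ ⟨_, ⟨x, hx, rfl⟩, rfl⟩
    rw [mem_closedBall_zero_iff] at hx
    dsimp only
    rw [hfx]
    obtain ⟨h2, h3⟩ := ht x hx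
    have h0 : 0 < c * θ := by positivity
    refine exists_norm_sub_smul_le_of_orthogonal hu (horth x) (h0.trans_le h2) hs.le ?_
    calc _ ≤ ρ ^ 2 * (1 - s ^ 2) := by have := hv x hx; gcongr
      _ = s ^ 2 * (c * θ) ^ 2 := by rw [mul_pow c, hc2, hρ]; ring
      _ ≤ _ := by gcongr

end Cap

/-! ### Covering all directions by few lines. -/

theorem exp_neg_one_le_one_sub_inv_pow {m : ℕ} (hm : 2 ≤ m) :
    Real.exp (-1) ≤ (1 - 1 / (m : ℝ)) ^ (m - 1) := by
  have hm' : (2 : ℝ) ≤ m := by exact_mod_cast hm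
  have hcast : ((m - 1 : ℕ) : ℝ) = m - 1 := by rw [Nat.cast_sub (by omega)]; simp
  have h1 : (0 : ℝ) < m - 1 := by linarith
  have h2 : Real.exp (-(1 / ((m : ℝ) - 1))) ≤ 1 - 1 / (m : ℝ) := by
    have := Real.add_one_le_exp (1 / ((m : ℝ) - 1))
    rw [Real.exp_neg, show 1 - 1 / (m : ℝ) = (1 / ((m : ℝ) - 1) + 1)⁻¹ by field_simp; ring]
    exact inv_anti₀ (by positivity) this
  calc Real.exp (-1) = Real.exp (-(1 / ((m : ℝ) - 1))) ^ (m - 1) := by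
        rw [← Real.exp_nat_mul, hcast]
        congr 1
        field_simp
    _ ≤ _ := by gcongr

/-- One factor `θ` comes from the inscribed ellipsoid and one from shrinking the cap to radius `θ *
s`; their powers cost at most e² < 8 together. The square root and 1 - θ are each at least 1/m,
whence 16m². -/
theorem cap_proportion_ge {m d : ℕ} (hm : 2 ≤ m) (hd : d ≤ m) {s θ : ℝ} (hs : 0 < s)
    (hs1 : s ≤ 1) (hθ : θ = 1 - 1 / (m : ℝ)) :
    s ^ (m - 1) / (16 * m ^ 2) ≤
      (θ * (θ * s)) ^ (d - 1) * (√(1 - (θ * s) ^ 2) * (1 - θ) / 2) := by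
  have hm' : (2 : ℝ) ≤ m := by exact_mod_cast hm
  have hmi : 1 / (m : ℝ) ≤ 1 / 2 := one_div_le_one_div_of_le two_pos hm'
  have hmi0 : 0 < 1 / (m : ℝ) := by positivity
  have hθ0 : 0 < θ := by linarith
  have hθ1 : θ < 1 := by linarith
  have hsqrt : 1 / (m : ℝ) ≤ √(1 - (θ * s) ^ 2) := by
    refine Real.le_sqrt_of_sq_le ?_
    have : (θ * s) ^ 2 ≤ θ ^ 2 := pow_le_pow_left₀ (by positivity) (by nlinarith) 2
    have e : 1 / (m : ℝ) = 1 - θ := by rw [hθ]; ring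
    rw [e]
    nlinarith
  have hpow : Real.exp (-1) ^ 2 * s ^ (m - 1) ≤ (θ * (θ * s)) ^ (d - 1) := by
    calc Real.exp (-1) ^ 2 * s ^ (m - 1) ≤ (θ ^ (m - 1)) ^ 2 * s ^ (m - 1) := by
          gcongr
          rw [hθ]
          exact exp_neg_one_le_one_sub_inv_pow hm
      _ = (θ * (θ * s)) ^ (m - 1) := by rw [← pow_mul, mul_comm (m - 1) 2, pow_mul, ← mul_pow]; ring
      _ ≤ _ := pow_le_pow_of_le_one (by positivity) (by nlinarith [mul_pos hθ0 hs]) (by omega)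
  have he : 1 / 8 ≤ Real.exp (-1) ^ 2 := by
    have h1 := Real.exp_one_lt_d9
    have h2 : Real.exp (-1) * Real.exp 1 = 1 := by rw [← Real.exp_add]; simp
    have h3 : 1 / 2.7182818286 ≤ Real.exp (-1) := by
      rw [div_le_iff₀ (by norm_num)]
      nlinarith [Real.exp_pos (-1)]
    calc (1 / 8 : ℝ) ≤ (1 / 2.7182818286) ^ 2 := by norm_num
      _ ≤ _ := by gcongr
  have e : 1 - θ = 1 / (m : ℝ) := by rw [hθ]; ring
  calc s ^ (m - 1) / (16 * m ^ 2)
      = (1 / 8 * s ^ (m - 1)) * (1 / (m : ℝ) * (1 / (m : ℝ)) / 2) := by field_simp; norm_num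
    _ ≤ _ := by
      rw [e]
      gcongr
      exact le_trans (by gcongr) hpow

open MeasureTheory Module in
/-- In dimension at most `m`, about `exp (σ (m - 1))` lines suffice to approximate every vector
with relative error `exp (-σ)`. -/
theorem exists_line_cover (E : Type*) [NormedAddCommGroup E] [InnerProductSpace ℝ E]
    [FiniteDimensional ℝ E] {m : ℕ} (hm : 2 ≤ m) (hd : finrank ℝ E ≤ m) {σ : ℝ} (hσ : 0 ≤ σ) :
    ∃ D : Finset E, (D.card : ℝ) ≤ 64 * m ^ 4 * (1 + σ) * Real.exp (σ * (m - 1)) ∧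
      ∀ z : E, ∃ φ ∈ D, ∃ x : ℝ, ‖z - x • φ‖ ≤ Real.exp (-σ) * ‖z‖ := by
  have hm' : (2 : ℝ) ≤ m := by exact_mod_cast hm
  have hexp1 : 1 ≤ Real.exp (σ * (m - 1)) :=
    Real.one_le_exp (mul_nonneg hσ (by linarith))
  have hm3 : (8 : ℝ) ≤ m ^ 3 := by
    calc (8 : ℝ) = 2 ^ 3 := by norm_num
      _ ≤ _ := by gcongr
  have hm4 : (m : ℝ) ^ 3 ≤ m ^ 4 := pow_le_pow_right₀ (by linarith) (by norm_num)
  rcases subsingleton_or_nontrivial E with hE | hE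
  · refine ⟨{0}, ?_, fun z => ⟨0, by simp, 0, by simp [Subsingleton.elim z 0]⟩⟩
    rw [Finset.card_singleton, Nat.cast_one]
    have : (1 : ℝ) ≤ 64 * m ^ 4 * (1 + σ) := by nlinarith
    nlinarith
  borelize E
  set s := Real.exp (-σ) with hs
  have hspos : 0 < s := Real.exp_pos _
  have hs1 : s ≤ 1 := Real.exp_le_one_iff.2 (by linarith)
  -- Error budget: s/m for the mesh of the net plus θs for the cap is exactly s.
  obtain ⟨θ, hθ⟩ : ∃ θ : ℝ, θ = 1 - 1 / (m : ℝ) := ⟨_, rfl⟩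
  have hmi : 1 / (m : ℝ) ≤ 1 / 2 := one_div_le_one_div_of_le two_pos hm'
  have hmi0 : 0 < 1 / (m : ℝ) := by positivity
  have hθ0 : 0 < θ := by linarith
  have hθ1 : θ < 1 := by linarith
  have hη : 0 < s / m := by positivity
  obtain ⟨T, hT1, hTc, hTnet⟩ := exists_sphere_net E hη
  let μ : Measure E := Measure.addHaar
  let B : Set E := Metric.closedBall 0 1
  have hB0 : μ B ≠ 0 := (Metric.measure_closedBall_pos μ _ one_pos).ne'
  have hBt : μ B ≠ ⊤ := measure_closedBall_lt_top.ne
  -- Vectors are drawn uniformly from the unit ball.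
  have : IsProbabilityMeasure (ProbabilityTheory.cond μ B) :=
    ProbabilityTheory.cond_isProbabilityMeasure_of_finite hB0 hBt
  have hcap : ∀ u : E, ∃ A : Set E, MeasurableSet A ∧ (‖u‖ = 1 →
      ENNReal.ofReal (s ^ (m - 1) / (16 * m ^ 2)) ≤ ProbabilityTheory.cond μ B A ∧
      ∀ φ ∈ A, ∃ x : ℝ, ‖u - x • φ‖ ≤ θ * s) := by
    intro u
    by_cases hu : ‖u‖ = 1
    · obtain ⟨A, h1, h2, h3, h4⟩ := exists_cap_measure_ge μ hu (s := θ * s) (θ := θ)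
        (by positivity) (by nlinarith) hθ0 hθ1
      refine ⟨A, h1, fun _ => ⟨?_, h4⟩⟩
      rw [ProbabilityTheory.cond_apply measurableSet_closedBall,
        Set.inter_eq_self_of_subset_right h2, h3, mul_left_comm,
        ENNReal.inv_mul_cancel hB0 hBt, mul_one]
      exact ENNReal.ofReal_le_ofReal (cap_proportion_ge hm hd hspos hs1 hθ)
    · exact ⟨∅, MeasurableSet.empty, fun h => absurd h hu⟩
  choose A hA1 hA2 using hcap
  have hTR : (T.card : ℝ) ≤ Real.exp (m * (3 * m - 1 + σ)) := by
    have h1 : 1 + 2 / (s / m) ≤ Real.exp (3 * m - 1 + σ) := by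
      calc 1 + 2 / (s / m) = 1 + 2 * m * Real.exp σ := by
            rw [hs, Real.exp_neg]; field_simp
        _ ≤ 3 * m * Real.exp σ := by nlinarith [Real.one_le_exp hσ]
        _ ≤ Real.exp (3 * m - 1) * Real.exp σ := by
            gcongr
            linarith [Real.add_one_le_exp (3 * (m : ℝ) - 1)]
        _ = _ := (Real.exp_add _ _).symm
    calc (T.card : ℝ) ≤ _ := hTc
      _ ≤ (1 + 2 / (s / m)) ^ m := pow_le_pow_right₀ (by simp; positivity) hd
      _ ≤ Real.exp (3 * m - 1 + σ) ^ m := by gcongr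
      _ = _ := (Real.exp_nat_mul _ _).symm
  obtain ⟨D, hDc, hD⟩ := exists_finset_hitting (ProbabilityTheory.cond μ B) T A
    (fun u _ => hA1 u) (p := s ^ (m - 1) / (16 * m ^ 2)) (by positivity)
    (by
      rw [div_le_one (by positivity)]
      exact (pow_le_one₀ hspos.le hs1).trans (by nlinarith))
    (fun u hu => (hA2 u (hT1 u hu)).1) hTR (by have : 0 ≤ 3 * (m : ℝ) - 1 + σ := by linarith
                                               positivity)
  have hunit : ∀ y : E, ‖y‖ = 1 → ∃ φ ∈ D, ∃ x : ℝ, ‖y - x • φ‖ ≤ s := by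
    intro y hy
    obtain ⟨u, hu, hyu⟩ := hTnet y hy
    obtain ⟨φ, hφ, hφA⟩ := hD u hu
    obtain ⟨x, hx⟩ := (hA2 u (hT1 u hu)).2 φ hφA
    refine ⟨φ, hφ, x, ?_⟩
    calc ‖y - x • φ‖ ≤ ‖y - u‖ + ‖u - x • φ‖ := norm_sub_le_norm_sub_add_norm_sub _ _ _
      _ ≤ s / m + θ * s := add_le_add hyu hx
      _ = s := by rw [hθ]; ring
  refine ⟨D, hDc.trans ?_, fun z => ?_⟩
  · have e : m * (3 * m - 1 + σ) / (s ^ (m - 1) / (16 * m ^ 2)) =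
        16 * (m : ℝ) ^ 3 * (3 * m - 1 + σ) * Real.exp (σ * (m - 1)) := by
      have : Real.exp (σ * (m - 1)) = (s ^ (m - 1))⁻¹ := by
        rw [hs, ← Real.exp_nat_mul, ← Real.exp_neg, Nat.cast_sub (by omega)]
        congr 1
        push_cast
        ring
      rw [this]
      field_simp
    rw [e]
    have h1 : 16 * (m : ℝ) ^ 3 * (3 * m - 1 + σ) + 1 ≤ 64 * m ^ 4 * (1 + σ) := by
      have h2 : 3 * (m : ℝ) - 1 + σ ≤ 3 * m * (1 + σ) := by nlinarith
      have h3 : 16 * (m : ℝ) ^ 3 * (3 * m - 1 + σ) ≤ 48 * m ^ 4 * (1 + σ) := by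
        calc _ ≤ 16 * (m : ℝ) ^ 3 * (3 * m * (1 + σ)) := by gcongr
          _ = _ := by ring
      nlinarith
    nlinarith
  · by_cases hz : z = 0
    · obtain ⟨y, hy⟩ := exists_norm_eq E zero_le_one
      obtain ⟨φ, hφ, -⟩ := hunit y hy
      exact ⟨φ, hφ, 0, by simp [hz]⟩
    · have hz' : 0 < ‖z‖ := norm_pos_iff.2 hz
      obtain ⟨φ, hφ, x, hx⟩ := hunit (‖z‖⁻¹ • z) (by rw [norm_smul, norm_inv, norm_norm]; field_simp)
      refine ⟨φ, hφ, ‖z‖ * x, ?_⟩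
      have : z - (‖z‖ * x) • φ = ‖z‖ • (‖z‖⁻¹ • z - x • φ) := by
        rw [smul_sub, smul_smul, smul_smul, mul_inv_cancel₀ hz'.ne', one_smul]
      rw [this, norm_smul, norm_norm, mul_comm]
      gcongr

/-! ### Composition of sparse approximations. -/

/-- Every vector is approximated with relative error at most `s` by some linear combination of `k`
elements of `C`. -/
def HasSparseApprox {n : ℕ} (C : Finset (EuclideanSpace ℝ (Fin n))) (k : ℕ) (s : ℝ) : Prop :=
  ∀ y, ∃ (x : Fin k → ℝ) (φ : Fin k → C),
    ‖y - ∑ i, x i • (φ i : EuclideanSpace ℝ (Fin n))‖ ≤ s * ‖y‖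

namespace HasSparseApprox
variable {n : ℕ} {C : Finset (EuclideanSpace ℝ (Fin n))}

theorem one_iff {s : ℝ} : HasSparseApprox C 1 s ↔
    ∀ y, ∃ φ ∈ C, ∃ x : ℝ, ‖y - x • φ‖ ≤ s * ‖y‖ := by
  constructor
  · intro h y
    obtain ⟨x, φ, hy⟩ := h y
    exact ⟨φ 0, (φ 0).2, x 0, by simpa using hy⟩
  · intro h y
    obtain ⟨φ, hφ, x, hy⟩ := h y
    exact ⟨fun _ => x, fun _ => ⟨φ, hφ⟩, by simpa using hy⟩

theorem zero : HasSparseApprox C 0 1 := fun y => ⟨Fin.elim0, Fin.elim0, by simp⟩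

/-- The second approximation is applied to the residual of the first. -/
theorem add {k l : ℕ} {s t : ℝ} (ht : 0 ≤ t) (h : HasSparseApprox C k s)
    (h' : HasSparseApprox C l t) : HasSparseApprox C (k + l) (s * t) := by
  intro y
  obtain ⟨x, φ, hy⟩ := h y
  obtain ⟨x', φ', hy'⟩ := h' (y - ∑ i, x i • (φ i : EuclideanSpace ℝ (Fin n)))
  refine ⟨Fin.append x x', Fin.append φ φ', ?_⟩
  rw [Fin.sum_univ_add]
  simp only [Fin.append_left, Fin.append_right]
  rw [← sub_sub]
  refine hy'.trans ?_
  calc _ ≤ t * (s * ‖y‖) := by gcongr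
    _ = _ := by ring

theorem mul {k : ℕ} {s : ℝ} (hs : 0 ≤ s) (h : HasSparseApprox C k s) (a : ℕ) :
    HasSparseApprox C (a * k) (s ^ a) := by
  induction a with
  | zero => simpa using zero
  | succ a ih =>
    rw [pow_succ, Nat.succ_mul]
    exact ih.add hs h

theorem worstDistortion_le {k : ℕ} {s : ℝ} (hs : 0 ≤ s) (h : HasSparseApprox C k s) :
    worstDistortion k C ≤ ENNReal.ofReal (s ^ 2) := by
  refine iSup₂_le fun y hy => ?_
  obtain ⟨x, φ, hxy⟩ := h y
  refine (iInf₂_le x φ).trans ?_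
  rw [ENNReal.ofReal_pow hs, ← ofReal_norm]
  gcongr
  nlinarith

/-- By minimality, each greedy step does at least as well as the one-term approximation of the
current error. -/
theorem greedyDistortion_le {s : ℝ} (hs : 0 ≤ s) (h : HasSparseApprox C 1 s) (k : ℕ) :
    greedyDistortion k C ≤ ENNReal.ofReal ((s ^ k) ^ 2) := by
  refine iSup₂_le fun y hy => iSup₂_le fun z hz => ?_
  have hk : ‖z k‖ ≤ s ^ k := by
    induction k with
    | zero => simpa [hz.1] using hy
    | succ k ih =>
      obtain ⟨φ, -, x, hzx, hmin⟩ := hz.2 k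
      obtain ⟨ψ, hψ, t, ht⟩ := one_iff.1 h (z k)
      rw [hzx, pow_succ']
      exact ((hmin ψ hψ t).trans ht).trans (by gcongr)
  rw [ENNReal.ofReal_pow (by positivity), ← ofReal_norm]
  gcongr

end HasSparseApprox

/-! ### Dictionaries built from coordinate blocks. -/

theorem norm_sq_eq_sum_norm_sq_of_blocks {ι β : Type*} [Fintype ι] [Fintype β] (f : ι → β)
    {w : EuclideanSpace ℝ ι} {v : β → EuclideanSpace ℝ ι} (h : ∀ i, w i = v (f i) i)
    (h' : ∀ b i, f i ≠ b → v b i = 0) : ‖w‖ ^ 2 = ∑ b, ‖v b‖ ^ 2 := by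
  simp_rw [EuclideanSpace.norm_sq_eq]
  rw [Finset.sum_comm]
  refine Finset.sum_congr rfl fun i _ => ?_
  rw [Finset.sum_eq_single (f i) (fun b _ hb => by simp [h' b i hb.symm]) (by simp), h]

/-- The vectors supported on the block `f ⁻¹' {b}` of coordinates. -/
def blockSubmodule {ι β : Type*} (f : ι → β) (b : β) : Submodule ℝ (EuclideanSpace ℝ ι) where
  carrier := {y | ∀ i, f i ≠ b → y i = 0}
  add_mem' hy hz i hi := by simp [hy i hi, hz i hi]
  zero_mem' := by simp
  smul_mem' c y hy i hi := by simp [hy i hi]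

open Module in
theorem finrank_blockSubmodule_le {ι β : Type*} [Fintype ι] [DecidableEq β] (f : ι → β) (b : β) :
    finrank ℝ (blockSubmodule f b) ≤ Fintype.card {i // f i = b} := by
  let g : blockSubmodule f b →ₗ[ℝ] ({i // f i = b} → ℝ) :=
    { toFun := fun y i => (y : EuclideanSpace ℝ ι) i
      map_add' := fun y z => by ext; simp
      map_smul' := fun c y => by ext; simp }
  rw [← finrank_fintype_fun_eq_card ℝ]
  refine LinearMap.finrank_le_finrank_of_injective (f := g) fun y z hyz => ?_
  ext i
  by_cases hi : f i = b
  · exact congrFun hyz ⟨i, hi⟩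
  · rw [y.2 i hi, z.2 i hi]

/-- The union of a line cover of the whole space and one of each block. Errors in different blocks
are orthogonal, so a relative error common to all blocks is also the relative error of the sum. -/
theorem exists_dictionary {n m B M : ℕ} (hm : 2 ≤ m) (hn : 2 ≤ n) (f : Fin n → Fin B)
    (hf : ∀ b, Fintype.card {i // f i = b} ≤ m) {σ τ : ℝ} (hσ : 0 ≤ σ) (hτ : 0 ≤ τ)
    (hM : 64 * (n : ℝ) ^ 4 * (1 + σ) * Real.exp (σ * (n - 1)) +
      B * (64 * (m : ℝ) ^ 4 * (1 + τ) * Real.exp (τ * (m - 1))) ≤ M) :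
    ∃ C : Finset (EuclideanSpace ℝ (Fin n)), C.card = M ∧ HasSparseApprox C 1 (Real.exp (-σ)) ∧
      HasSparseApprox C B (Real.exp (-τ)) := by
  classical
  obtain ⟨D, hDc, hD⟩ := exists_line_cover (EuclideanSpace ℝ (Fin n)) hn (by simp) hσ
  have hb := fun b => exists_line_cover (blockSubmodule f b) hm
    ((finrank_blockSubmodule_le f b).trans (hf b)) hτ
  choose F hFc hF using hb
  let G : Finset (EuclideanSpace ℝ (Fin n)) :=
    Finset.univ.biUnion fun b => (F b).image Subtype.val
  have hcard : (D ∪ G).card ≤ M := by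
    rw [← Nat.cast_le (α := ℝ)]
    have h1 : (G.card : ℝ) ≤ B * (64 * (m : ℝ) ^ 4 * (1 + τ) * Real.exp (τ * (m - 1))) := by
      calc (G.card : ℝ) ≤ ∑ b, ((F b).card : ℝ) := by
            exact_mod_cast Finset.card_biUnion_le.trans
              (Finset.sum_le_sum fun b _ => Finset.card_image_le)
        _ ≤ ∑ b : Fin B, 64 * (m : ℝ) ^ 4 * (1 + τ) * Real.exp (τ * (m - 1)) :=
            Finset.sum_le_sum fun b _ => hFc b
        _ = _ := by simp
    have h2 : ((D ∪ G).card : ℝ) ≤ D.card + G.card := by exact_mod_cast Finset.card_union_le _ _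
    linarith
  have : Nonempty (Fin n) := ⟨⟨0, by omega⟩⟩
  have : Infinite (EuclideanSpace ℝ (Fin n)) := Module.Free.infinite ℝ _
  -- Arbitrary further vectors bring the cardinality to exactly `M`; enlarging a dictionary does no
  -- harm.
  obtain ⟨C, hsub, hC⟩ := Infinite.exists_superset_card_eq (D ∪ G) M hcard
  refine ⟨C, hC, HasSparseApprox.one_iff.2 fun y => ?_, fun y => ?_⟩
  · obtain ⟨φ, hφ, h⟩ := hD y
    exact ⟨φ, hsub (Finset.mem_union_left _ hφ), h⟩
  · let P : (b : Fin B) → blockSubmodule f b := fun b =>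
      ⟨WithLp.toLp 2 fun i => if f i = b then y i else 0, fun i hi => by simp [hi]⟩
    choose φ hφ x hx using fun b => hF b (P b)
    refine ⟨x, fun b => ⟨φ b, hsub (Finset.mem_union_right _ (Finset.mem_biUnion.2
      ⟨b, Finset.mem_univ _, Finset.mem_image_of_mem _ (hφ b)⟩))⟩, ?_⟩
    refine le_of_sq_le_sq ?_ (by positivity)
    have hy : ‖y‖ ^ 2 = ∑ b, ‖(P b : EuclideanSpace ℝ (Fin n))‖ ^ 2 :=
      norm_sq_eq_sum_norm_sq_of_blocks f (fun i => by simp [P]) fun b => (P b).2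
    rw [mul_pow, hy, Finset.mul_sum,
      norm_sq_eq_sum_norm_sq_of_blocks f
        (v := fun b => ((P b - x b • φ b : blockSubmodule f b) : EuclideanSpace ℝ (Fin n)))
        (fun i => ?_) (fun b => (P b - x b • φ b).2)]
    · refine Finset.sum_le_sum fun b _ => ?_
      rw [← mul_pow]
      exact pow_le_pow_left₀ (norm_nonneg _) (hx b) 2
    · simp only [PiLp.sub_apply, WithLp.ofLp_sum, Finset.sum_apply, PiLp.smul_apply,
        Submodule.coe_sub, Submodule.coe_smul]
      rw [Finset.sum_eq_single (f i) (fun b _ hb => by rw [(φ b).2 i hb.symm, smul_zero])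
        (by simp)]
      simp [P]

/-! ### Choice of parameters and size of the losses. -/

/-- The logarithm of the polynomial overcounting factor of the dictionary in dimension `n` whose
size has logarithm `ℓ`. -/
noncomputable def logOverhead (n : ℕ) (ℓ : ℝ) : ℝ := Real.log (128 * n ^ 5 * (1 + ℓ))

/-- The size of the coordinate blocks in dimension `n`. -/
def blockSize (n : ℕ) : ℕ := Nat.sqrt (n / 2)

/-- The number of coordinate blocks in dimension `n`. -/
def blockCount (n : ℕ) : ℕ := (n - 1) / blockSize n + 1

/-- A bound for the loss in the exponent in one step of the successive representation. -/
noncomputable def stepLoss (n : ℕ) : ℝ := Real.log (128 * n ^ 6) / (n - 1)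

theorem two_le_blockSize {n : ℕ} (hn : 8 ≤ n) : 2 ≤ blockSize n :=
  Nat.le_sqrt.2 (by omega)

theorem two_mul_blockSize_sq_le (n : ℕ) : 2 * blockSize n ^ 2 ≤ n := by
  have := Nat.sqrt_le' (n / 2)
  unfold blockSize
  omega

theorem lt_two_mul_blockSize_succ_sq (n : ℕ) : n < 2 * (blockSize n + 1) ^ 2 := by
  have := Nat.lt_succ_sqrt' (n / 2)
  simp only [Nat.succ_eq_add_one] at this
  unfold blockSize
  omega

theorem blockCount_mul_blockSize_le {n : ℕ} (hn : 1 ≤ n) :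
    blockCount n * blockSize n + 1 ≤ n + blockSize n := by
  have := Nat.div_mul_le_self (n - 1) (blockSize n)
  rw [blockCount, Nat.succ_mul]
  omega

theorem blockCount_le {n : ℕ} (hn : 1 ≤ n) : blockCount n ≤ n := by
  have := Nat.div_le_self (n - 1) (blockSize n)
  unfold blockCount
  omega

theorem card_block_le {n m B : ℕ} (hm : 0 < m) (f : Fin n → Fin B)
    (hf : ∀ i, (f i : ℕ) = i / m) (b : Fin B) : Fintype.card {i // f i = b} ≤ m := by
  rw [← Fintype.card_fin m]
  refine Fintype.card_le_of_injective
    (fun i : {i // f i = b} => (⟨(i : Fin n) % m, Nat.mod_lt _ hm⟩ : Fin m)) ?_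
  rintro ⟨i, hi⟩ ⟨j, hj⟩ hij
  have h1 : (i : ℕ) % m = j % m := congrArg Fin.val hij
  have h2 : (i : ℕ) / m = j / m := by rw [← hf, ← hf, hi, hj]
  ext
  dsimp only
  rw [← Nat.div_add_mod (i : ℕ) m, ← Nat.div_add_mod (j : ℕ) m, h1, h2]

theorem exists_dictionary_of_logOverhead_le {n M : ℕ} (hn : 8 ≤ n) (hM : 0 < M)
    (hL : logOverhead n (Real.log M) ≤ Real.log M) :
    ∃ C : Finset (EuclideanSpace ℝ (Fin n)), C.card = M ∧
      HasSparseApprox C 1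
        (Real.exp (-((Real.log M - logOverhead n (Real.log M)) / (n - 1)))) ∧
      HasSparseApprox C (blockCount n)
        (Real.exp (-((Real.log M - logOverhead n (Real.log M)) / (blockSize n - 1)))) := by
  have hm := two_le_blockSize hn
  have hn' : (8 : ℝ) ≤ n := by exact_mod_cast hn
  have hM' : (0 : ℝ) < M := by exact_mod_cast hM
  have hℓ : 0 ≤ Real.log M := Real.log_natCast_nonneg M
  set ℓ := Real.log M with hℓdef
  set L := logOverhead n ℓ with hLdef
  have hL0 : 0 ≤ L := by
    refine Real.log_nonneg ?_
    have : (1 : ℝ) ≤ n ^ 5 := one_le_pow₀ (by linarith)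
    nlinarith
  have hexp : Real.exp (ℓ - L) = M / (128 * n ^ 5 * (1 + ℓ)) := by
    rw [Real.exp_sub, hℓdef, Real.exp_log hM', hLdef, logOverhead, Real.exp_log (by positivity)]
  -- Each of the 1 + B ≤ 2n covers may use M/(2n) elements; this is where 128n⁵ = 64n⁴ · 2n comes
  -- from.
  have cost : ∀ d : ℕ, 2 ≤ d → d ≤ n → 64 * (d : ℝ) ^ 4 * (1 + (ℓ - L) / (d - 1)) *
      Real.exp ((ℓ - L) / (d - 1) * (d - 1)) ≤ M / (2 * n) := by
    intro d hd hdn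
    have hd' : (2 : ℝ) ≤ d := by exact_mod_cast hd
    have hdn' : (d : ℝ) ≤ n := by exact_mod_cast hdn
    have h1 : (0 : ℝ) < d - 1 := by linarith
    rw [div_mul_cancel₀ _ h1.ne', hexp]
    have h2 : (ℓ - L) / (d - 1) ≤ ℓ := by
      rw [div_le_iff₀ h1]
      nlinarith
    calc _ ≤ 64 * (n : ℝ) ^ 4 * (1 + ℓ) * (M / (128 * n ^ 5 * (1 + ℓ))) := by gcongr
      _ = _ := by field_simp; norm_num
  have hmn : blockSize n ≤ n := by nlinarith [two_mul_blockSize_sq_le n]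
  refine exists_dictionary (f := fun i => ⟨i / blockSize n, Nat.lt_succ_of_le
      (Nat.div_le_div_right (by omega))⟩) hm (by omega)
    (card_block_le (by omega) _ fun _ => rfl) ?_ ?_ ?_
  · exact div_nonneg (by linarith) (by linarith)
  · have : (2 : ℝ) ≤ blockSize n := by exact_mod_cast hm
    exact div_nonneg (by linarith) (by linarith)
  · have h1 := cost n (by omega) le_rfl
    have h2 := cost (blockSize n) hm hmn
    have h3 : (blockCount n : ℝ) ≤ n := by exact_mod_cast blockCount_le (by omega)
    calc _ ≤ (M : ℝ) / (2 * n) + n * (M / (2 * n)) := by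
          refine add_le_add h1 (mul_le_mul h3 h2 ?_ (by positivity))
          have h4 : (2 : ℝ) ≤ blockSize n := by exact_mod_cast hm
          have := div_nonneg (sub_nonneg.2 hL) (show (0 : ℝ) ≤ blockSize n - 1 by linarith)
          positivity
      _ ≤ n * (M / (2 * n)) + n * (M / (2 * n)) := by
        gcongr
        exact le_mul_of_one_le_left (by positivity) (by linarith)
      _ = M := by field_simp; norm_num

/-- After multiplication by n - 1 the left side is L - ℓ/n, where L = `logOverhead n ℓ`. The tangent
bound log(1 + ℓ) ≤ ℓ/n + log n absorbs ℓ, so the loss is bounded uniformly in ℓ, however fast `M`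
grows. -/
theorem div_sub_div_le_stepLoss {n : ℕ} (hn : 2 ≤ n) {ℓ : ℝ} (hℓ : 0 ≤ ℓ) :
    ℓ / n - (ℓ - logOverhead n ℓ) / (n - 1) ≤ stepLoss n := by
  have hn' : (2 : ℝ) ≤ n := by exact_mod_cast hn
  have h1 : (0 : ℝ) < n - 1 := by linarith
  have hlog : Real.log (1 + ℓ) ≤ ℓ / n + Real.log n := by
    have := Real.log_le_sub_one_of_pos (show 0 < (1 + ℓ) / n by positivity)
    rw [Real.log_div (by positivity) (by positivity), add_div] at this
    have : 1 / (n : ℝ) ≤ 1 := by rw [div_le_one (by linarith)]; linarith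
    linarith
  have e1 : logOverhead n ℓ = Real.log (128 * n ^ 5) + Real.log (1 + ℓ) :=
    Real.log_mul (by positivity) (by positivity)
  have e2 : Real.log (128 * (n : ℝ) ^ 6) = Real.log (128 * n ^ 5) + Real.log n := by
    rw [← Real.log_mul (by positivity) (by positivity)]
    ring_nf
  rw [stepLoss, le_div_iff₀ h1, e2, sub_mul, div_mul_cancel₀ _ h1.ne', e1]
  have e3 : ℓ / n * ((n : ℝ) - 1) = ℓ - ℓ / n := by field_simp
  rw [e3]
  linarith

theorem tendsto_log_mul_pow_div_sqrt :
    Tendsto (fun n : ℕ => Real.log (512 * n ^ 6) / √n) atTop (𝓝 0) := by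
  have h1 : Tendsto (fun x : ℝ => Real.log x / √x) atTop (𝓝 0) := by
    simp_rw [Real.sqrt_eq_rpow]
    exact (isLittleO_log_rpow_atTop (by norm_num)).tendsto_div_nhds_zero
  have h2 : Tendsto (fun x : ℝ => Real.log 512 / √x) atTop (𝓝 0) :=
    tendsto_const_nhds.div_atTop Real.tendsto_sqrt_atTop
  have h3 := (h2.add (h1.const_mul 6)).comp tendsto_natCast_atTop_atTop
  rw [mul_zero, add_zero] at h3
  refine h3.congr' ?_
  filter_upwards [eventually_ge_atTop 1] with n hn
  have : (0 : ℝ) < n := by exact_mod_cast hn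
  simp only [Function.comp]
  rw [Real.log_mul (by norm_num) (by positivity), Real.log_pow]
  push_cast
  ring

theorem stepLoss_nonneg {n : ℕ} (hn : 1 ≤ n) : 0 ≤ stepLoss n := by
  have hn' : (1 : ℝ) ≤ n := by exact_mod_cast hn
  have : (1 : ℝ) ≤ n ^ 6 := one_le_pow₀ hn'
  exact div_nonneg (Real.log_nonneg (by linarith)) (by linarith)

theorem blockCount_le_sqrt {n : ℕ} (hn : 8 ≤ n) : (blockCount n : ℝ) ≤ 4 * √n := by
  have hm : (2 : ℝ) ≤ blockSize n := by exact_mod_cast two_le_blockSize hn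
  have hn' : (8 : ℝ) ≤ n := by exact_mod_cast hn
  have h1 : (blockCount n : ℝ) * blockSize n + 1 ≤ n + blockSize n := by
    exact_mod_cast blockCount_mul_blockSize_le (n := n) (by omega)
  have h2 : (n : ℝ) < 2 * (blockSize n + 1) ^ 2 := by
    exact_mod_cast lt_two_mul_blockSize_succ_sq n
  have h3 : √(n : ℝ) ^ 2 = n := Real.sq_sqrt (by linarith)
  have h4 : 2 ≤ √(n : ℝ) := Real.le_sqrt_of_sq_le (by linarith)
  set m : ℝ := (blockSize n : ℝ)
  set q := √(n : ℝ)
  have h5 : q ≤ 9 / 4 * m := by nlinarith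
  have h6 : (blockCount n : ℝ) * m ≤ 4 * q * m := by nlinarith
  exact le_of_mul_le_mul_right h6 (by linarith)

/-- Bounds the total loss of an incomplete round of fewer than B terms: B = O(√n) against a loss of
O(log n / n) per term. -/
theorem tendsto_blockCount_mul_stepLoss :
    Tendsto (fun n : ℕ => blockCount n * stepLoss n) atTop (𝓝 0) := by
  have h := tendsto_log_mul_pow_div_sqrt.const_mul 8
  rw [mul_zero] at h
  refine squeeze_zero' ?_ ?_ h
  · filter_upwards [eventually_ge_atTop 1] with n hn
    exact mul_nonneg (Nat.cast_nonneg _) (stepLoss_nonneg hn)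
  · filter_upwards [eventually_ge_atTop 8] with n hn
    have hn' : (8 : ℝ) ≤ n := by exact_mod_cast hn
    have hlog : Real.log (128 * (n : ℝ) ^ 6) ≤ Real.log (512 * n ^ 6) :=
      Real.log_le_log (by positivity) (by gcongr; norm_num)
    have hlog0 : 0 ≤ Real.log (512 * (n : ℝ) ^ 6) := by
      have : (1 : ℝ) ≤ n ^ 6 := one_le_pow₀ (by linarith)
      exact Real.log_nonneg (by linarith)
    have h3 : √(n : ℝ) ^ 2 = n := Real.sq_sqrt (by linarith)
    have hq : 0 < √(n : ℝ) := Real.sqrt_pos.2 (by linarith)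
    calc (blockCount n : ℝ) * stepLoss n
        ≤ 4 * √n * (Real.log (512 * n ^ 6) / (n / 2)) := by
          rw [stepLoss]
          gcongr
          · exact stepLoss_nonneg (by omega)
          · exact blockCount_le_sqrt hn
          · linarith
      _ = 8 * (Real.log (512 * n ^ 6) / √n) := by
          field_simp
          rw [h3]
          ring

theorem tendsto_stepLoss : Tendsto stepLoss atTop (𝓝 0) := by
  refine squeeze_zero' ?_ ?_ tendsto_blockCount_mul_stepLoss
  · filter_upwards [eventually_ge_atTop 1] with n hn using stepLoss_nonneg hn
  · filter_upwards [eventually_ge_atTop 1] with n hn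
    refine le_mul_of_one_le_left (stepLoss_nonneg hn) ?_
    exact_mod_cast Nat.le_add_left 1 _

/-- The second inequality makes a block round lossless. Replacing m by m - 1 gains ℓ/(m(m - 1)).
Half of this covers the rounding in B, since 2m² ≤ n; the other half covers L = `logOverhead n ℓ`,
since 2mL ≤ ℓ: here ℓ/m is at least of order √n, while L is logarithmic in n and ℓ. -/
theorem eventually_logOverhead_le {c : ℝ} (hc : 0 < c) : ∀ᶠ n : ℕ in atTop, ∀ ℓ : ℝ, c * n ≤ ℓ →
    logOverhead n ℓ ≤ ℓ ∧
      blockCount n * (ℓ / n) ≤ (ℓ - logOverhead n ℓ) / (blockSize n - 1) := by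
  filter_upwards [eventually_ge_atTop 8, tendsto_log_mul_pow_div_sqrt.eventually_le_const
    (show 0 < c / 4 by positivity)] with n hn hlogn ℓ hℓ
  have hn' : (8 : ℝ) ≤ n := by exact_mod_cast hn
  have hm : (2 : ℝ) ≤ blockSize n := by exact_mod_cast two_le_blockSize hn
  have hBm : (blockCount n : ℝ) * blockSize n + 1 ≤ n + blockSize n := by
    exact_mod_cast blockCount_mul_blockSize_le (n := n) (by omega)
  have hmn : 2 * (blockSize n : ℝ) ^ 2 ≤ n := by exact_mod_cast two_mul_blockSize_sq_le n
  set m : ℝ := (blockSize n : ℝ)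
  have hℓ0 : 0 < ℓ := lt_of_lt_of_le (by positivity) hℓ
  have hq : 0 < √(n : ℝ) := Real.sqrt_pos.2 (by linarith)
  have hq2 : √(n : ℝ) ^ 2 = n := Real.sq_sqrt (by linarith)
  have hmq : m ≤ √(n : ℝ) := Real.le_sqrt_of_sq_le (by nlinarith)
  have hlog : Real.log (1 + ℓ) ≤ ℓ / (4 * m) + Real.log (4 * m) := by
    have := Real.log_le_sub_one_of_pos (show 0 < (1 + ℓ) / (4 * m) by positivity)
    rw [Real.log_div (by positivity) (by positivity), add_div] at this
    have : 1 / (4 * m) ≤ 1 := by rw [div_le_one (by linarith)]; linarith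
    linarith
  have e1 : logOverhead n ℓ = Real.log (128 * n ^ 5) + Real.log (1 + ℓ) :=
    Real.log_mul (by positivity) (by positivity)
  have h512 : Real.log (128 * (n : ℝ) ^ 5) + Real.log (4 * m) ≤ Real.log (512 * n ^ 6) := by
    rw [← Real.log_mul (by positivity) (by positivity)]
    refine Real.log_le_log (by positivity) ?_
    have : m ≤ n := by nlinarith
    calc 128 * (n : ℝ) ^ 5 * (4 * m) ≤ 128 * (n : ℝ) ^ 5 * (4 * n) := by gcongr
      _ = _ := by ring
  have hL : 2 * m * logOverhead n ℓ ≤ ℓ := by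
    have h1 : logOverhead n ℓ ≤ Real.log (512 * n ^ 6) + ℓ / (4 * m) := by linarith
    have h2 : m * Real.log (512 * n ^ 6) ≤ c / 4 * n := by
      rw [div_le_iff₀ hq] at hlogn
      calc _ ≤ m * (c / 4 * √n) := by gcongr
        _ ≤ √n * (c / 4 * √n) := by gcongr
        _ = c / 4 * √n ^ 2 := by ring
        _ = _ := by rw [hq2]
    have h3 : 2 * m * (ℓ / (4 * m)) = ℓ / 2 := by field_simp; norm_num
    calc _ ≤ 2 * m * (Real.log (512 * n ^ 6) + ℓ / (4 * m)) := by gcongr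
      _ ≤ ℓ := by rw [mul_add, h3]; linarith
  refine ⟨by nlinarith, ?_⟩
  rw [le_div_iff₀ (by linarith), ← mul_div_assoc, div_mul_eq_mul_div, div_le_iff₀ (by linarith)]
  refine le_of_mul_le_mul_left ?_ (show 0 < m by linarith)
  -- From Bm ≤ n + m - 1 the left side is at most mn - n + (m - 1)², and (m - 1)² ≤ n/2.
  have h1 : (m - 1) * (blockCount n * m) ≤ m * n - n / 2 := by nlinarith
  have h2 := mul_le_mul_of_nonneg_right h1 hℓ0.le
  nlinarith

/-! ### Distortion bounds and limits. -/

theorem eventually_exists_dictionary {M : ℕ → ℕ} {c : ℝ} (hc : 0 < c)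
    (hM : ∀ᶠ n : ℕ in atTop, c ≤ Real.log (M n) / n) :
    ∀ᶠ n : ℕ in atTop, ∃ C : Finset (EuclideanSpace ℝ (Fin n)), C.card = M n ∧
      (∀ k : ℕ, worstDistortion k C ≤ ENNReal.ofReal
        (Real.exp (2 * (blockCount n * stepLoss n) - 2 * k * (Real.log (M n) / n)))) ∧
      ∀ k : ℕ, greedyDistortion k C ≤ ENNReal.ofReal
        (Real.exp (2 * k * stepLoss n - 2 * k * (Real.log (M n) / n))) := by
  filter_upwards [eventually_ge_atTop 8, eventually_logOverhead_le hc, hM] with n hn hev hMn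
  have hn' : (8 : ℝ) ≤ n := by exact_mod_cast hn
  rw [le_div_iff₀ (by linarith)] at hMn
  obtain ⟨h1, h2⟩ := hev _ hMn
  have hpos : 0 < M n := by
    refine Nat.pos_of_ne_zero fun h0 => ?_
    rw [h0, Nat.cast_zero, Real.log_zero] at hMn
    have : 0 < c * n := by positivity
    linarith
  obtain ⟨C, hC, hfull, hblock⟩ := exists_dictionary_of_logOverhead_le hn hpos h1
  have h3 := div_sub_div_le_stepLoss (n := n) (by omega) (Real.log_natCast_nonneg (M n))
  have hδ := stepLoss_nonneg (n := n) (by omega)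
  set ℓ := Real.log (M n)
  set σ := (ℓ - logOverhead n ℓ) / ((n : ℝ) - 1)
  set τ := (ℓ - logOverhead n ℓ) / ((blockSize n : ℝ) - 1)
  refine ⟨C, hC, fun k => ?_, fun k => ?_⟩
  -- Take `a` lossless block rounds and r < B single terms, so the loss is bounded independently of
  -- k.
  · obtain ⟨a, r, hr, rfl⟩ : ∃ a r, r < blockCount n ∧ k = r * 1 + a * blockCount n :=
      ⟨k / blockCount n, k % blockCount n, Nat.mod_lt _ (Nat.succ_pos _), by
        rw [mul_one, Nat.mod_add_div']⟩
    refine (((hfull.mul (Real.exp_pos _).le r).add (by positivity)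
      (hblock.mul (Real.exp_pos _).le a)).worstDistortion_le (by positivity)).trans ?_
    rw [← Real.exp_nat_mul, ← Real.exp_nat_mul, ← Real.exp_add, ← Real.exp_nat_mul]
    refine ENNReal.ofReal_le_ofReal (Real.exp_le_exp.2 ?_)
    have h4 : (a : ℝ) * (blockCount n * (ℓ / n)) ≤ a * τ := by gcongr
    have h5 : (r : ℝ) * (ℓ / n - σ) ≤ r * stepLoss n := by gcongr
    have h6 : (r : ℝ) * stepLoss n ≤ blockCount n * stepLoss n := by gcongr
    push_cast
    linarith
  · refine (hfull.greedyDistortion_le (Real.exp_pos _).le k).trans ?_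
    rw [← Real.exp_nat_mul, ← Real.exp_nat_mul]
    refine ENNReal.ofReal_le_ofReal (Real.exp_le_exp.2 ?_)
    have h5 : (k : ℝ) * (ℓ / n - σ) ≤ k * stepLoss n := by gcongr
    push_cast
    linarith

theorem log_add_coe_le {d : ℝ≥0∞} {a b : ℝ} (h : d ≤ ENNReal.ofReal (Real.exp (a - b))) :
    ENNReal.log d + (b : EReal) ≤ a := by
  have h1 := ENNReal.log_monotone h
  rw [ENNReal.log_ofReal_of_pos (Real.exp_pos _), Real.log_exp] at h1
  calc _ ≤ ((a - b : ℝ) : EReal) + b := by gcongr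
    _ = a := by rw [← EReal.coe_add, sub_add_cancel]

theorem limsup_coe_add_le_zero {d : ℕ → ℝ≥0∞} {a b : ℕ → ℝ} (ha : Tendsto a atTop (𝓝 0))
    (h : ∀ᶠ n in atTop, d n ≤ ENNReal.ofReal (Real.exp (a n - b n))) :
    limsup (fun n => ENNReal.log (d n) + (b n : EReal)) atTop ≤ 0 := by
  have ha' : Tendsto (fun n => (a n : EReal)) atTop (𝓝 0) :=
    (continuous_coe_real_ereal.tendsto 0).comp ha
  rw [← ha'.limsup_eq]
  exact limsup_le_limsup (h.mono fun n hn => log_add_coe_le hn)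

theorem theorem1 (M : ℕ → ℕ)
    (hM : 0 < liminf (fun n : ℕ => ((Real.log (M n) / n : ℝ) : EReal)) atTop) :
    ∃ C : (n : ℕ) → Finset (EuclideanSpace ℝ (Fin n)),
      (∀ n, 1 ≤ n → (C n).card = M n) ∧
      (∀ k : ℕ → ℕ,
        limsup (fun n : ℕ => ENNReal.log (worstDistortion (k n) (C n)) +
          ((2 * k n * Real.log (M n) / n : ℝ) : EReal)) atTop ≤ 0) ∧
      (∀ k : ℕ → ℕ, Tendsto k atTop atTop →
        Tendsto (fun n : ℕ => worstDistortion (k n) (C n)) atTop (𝓝 0)) ∧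
      (∀ k : ℕ,
        limsup (fun n : ℕ => ENNReal.log (greedyDistortion k (C n)) +
          ((2 * k * Real.log (M n) / n : ℝ) : EReal)) atTop ≤ 0) ∧
      (∀ ε : ℝ, 0 < ε → ∀ᶠ n : ℕ in atTop, ∀ k : ℕ,
        greedyDistortion k (C n) ≤
          ENNReal.ofReal (Real.exp (-2 * k * (Real.log (M n) / n - ε)))) := by
  classical
  -- A real `c` below the lower limit also covers the value +∞.
  obtain ⟨c, hc0, hc⟩ := EReal.lt_iff_exists_real_btwn.1 hM
  rw [EReal.coe_pos] at hc0
  have hMc : ∀ᶠ n : ℕ in atTop, c ≤ Real.log (M n) / n := by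
    filter_upwards [eventually_lt_of_lt_liminf hc] with n hn
    exact (EReal.coe_lt_coe_iff.1 hn).le
  have hex := eventually_exists_dictionary hc0 hMc
  -- Where no good dictionary exists, any set of the right size serves; this concerns finitely many
  -- n. For n = 0 the space is a single point, so the cardinality is required only for n ≥ 1.
  have hC : ∀ n : ℕ, ∃ C : Finset (EuclideanSpace ℝ (Fin n)), (1 ≤ n → C.card = M n) ∧
      ((∃ C : Finset (EuclideanSpace ℝ (Fin n)), C.card = M n ∧
      (∀ k : ℕ, worstDistortion k C ≤ ENNReal.ofReal
        (Real.exp (2 * (blockCount n * stepLoss n) - 2 * k * (Real.log (M n) / n)))) ∧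
      ∀ k : ℕ, greedyDistortion k C ≤ ENNReal.ofReal
        (Real.exp (2 * k * stepLoss n - 2 * k * (Real.log (M n) / n)))) →
      (∀ k : ℕ, worstDistortion k C ≤ ENNReal.ofReal
        (Real.exp (2 * (blockCount n * stepLoss n) - 2 * k * (Real.log (M n) / n)))) ∧
      ∀ k : ℕ, greedyDistortion k C ≤ ENNReal.ofReal
        (Real.exp (2 * k * stepLoss n - 2 * k * (Real.log (M n) / n)))) := by
    intro n
    by_cases h : ∃ C : Finset (EuclideanSpace ℝ (Fin n)), C.card = M n ∧
      (∀ k : ℕ, worstDistortion k C ≤ ENNReal.ofReal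
        (Real.exp (2 * (blockCount n * stepLoss n) - 2 * k * (Real.log (M n) / n)))) ∧
      ∀ k : ℕ, greedyDistortion k C ≤ ENNReal.ofReal
        (Real.exp (2 * k * stepLoss n - 2 * k * (Real.log (M n) / n)))
    · obtain ⟨C, h1, h2⟩ := h
      exact ⟨C, fun _ => h1, fun _ => h2⟩
    · rcases Nat.eq_zero_or_pos n with rfl | hn
      · exact ⟨∅, by omega, fun h' => absurd h' h⟩
      · have : Nonempty (Fin n) := ⟨⟨0, hn⟩⟩
        have : Infinite (EuclideanSpace ℝ (Fin n)) := Module.Free.infinite ℝ _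
        obtain ⟨C, hC⟩ := Infinite.exists_subset_card_eq (EuclideanSpace ℝ (Fin n)) (M n)
        exact ⟨C, fun _ => hC, fun h' => absurd h' h⟩
  choose C hcard hgood using hC
  have hgood' := hex.mono fun n hn => hgood n hn
  have hBδ := tendsto_blockCount_mul_stepLoss.const_mul 2
  rw [mul_zero] at hBδ
  refine ⟨C, hcard, fun k => ?_, fun k hk => ?_, fun k => ?_, fun ε hε => ?_⟩
  · refine limsup_coe_add_le_zero hBδ (hgood'.mono fun n hn => ?_)
    rw [mul_div_assoc]
    exact hn.1 (k n)
  -- The 1 eventually dominates the vanishing loss 2B · `stepLoss n`.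
  · have hbound : Tendsto (fun n => ENNReal.ofReal (Real.exp (1 - 2 * c * k n))) atTop (𝓝 0) := by
      rw [← ENNReal.ofReal_zero]
      refine ENNReal.tendsto_ofReal (Real.tendsto_exp_atBot.comp ?_)
      refine tendsto_atBot_add_const_left _ 1 (tendsto_neg_atTop_atBot.comp ?_)
      exact (tendsto_natCast_atTop_atTop.comp hk).const_mul_atTop (by positivity)
    refine tendsto_of_tendsto_of_tendsto_of_le_of_le' tendsto_const_nhds hbound
      (Eventually.of_forall fun _ => zero_le) ?_
    filter_upwards [hgood', hMc, hBδ.eventually_le_const one_pos] with n h1 h2 h3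
    refine (h1.1 (k n)).trans (ENNReal.ofReal_le_ofReal (Real.exp_le_exp.2 ?_))
    have : (k n : ℝ) * c ≤ k n * (Real.log (M n) / n) := by gcongr
    linarith
  · have hkδ := tendsto_stepLoss.const_mul (2 * (k : ℝ))
    rw [mul_zero] at hkδ
    refine limsup_coe_add_le_zero hkδ (hgood'.mono fun n hn => ?_)
    rw [mul_div_assoc]
    exact hn.2 k
  · filter_upwards [hgood', tendsto_stepLoss.eventually_le_const hε] with n h1 h2 k
    refine (h1.2 k).trans (ENNReal.ofReal_le_ofReal (Real.exp_le_exp.2 ?_))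
    have : (k : ℝ) * stepLoss n ≤ k * ε := by gcongr
    linarith
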